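/- Let $k$ be a field of characteristic different from $2$. For $a_1,\dots,a_n\in k^\times$ ($n\ge 0$), the $n$-fold Pfister form $\langle\langle a_1,\dots,a_n\rangle\rangle$ is the quadratic form $\prod_{i=1}^n\langle 1,-a_i\rangle$ of dimension $2^n$. A regular quadratic form $q$ over $k$ is a Pfister neighbor with associated Pfister form $\phi$ if $\phi$ is (isometric to) an $n$-fold Pfister form with $2^{n-1}<\dim q$ and $\langle c\rangle\cdot q$ is isometric to a subform of $\phi$ for some $c\in k^\times$. For a $k$-scheme $X$ locally of finite type, choose a nonzero $k$-linear functional $s_x\colon k(x)\to k$ for every closed point $x$ of $X$, and let the transfer ideal of $X$ be \[ \mathrm{GI}^{\mathrm{tr}}_X=\sum_{x}(s_x)_*\big(\mathrm{GW}(k(x))\big)\subseteq \mathrm{GW}(k), \] where $x$ runs over the closed points of $X$, $\mathrm{GW}$ denotes the Grothendieck–Witt ring of regular quadratic forms, and $(s_x)_*\colon \mathrm{GW}(k(x))\to\mathrm{GW}(k)$ is Scharlau's transfer, the additive map sending the class of a form $\psi$ to the class of the $k$-form $v\mapsto s_x(\psi(v))$. For a quadratic form $q$ let $D(q)\subseteq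 k^\times$ be its set of nonzero values, and let $[D(q)^2]$ be the subgroup of $k^\times$ generated by all products $ab$ with $a,b\in D(q)$. Let $q$ be a Pfister neighbor over $k$ with associated Pfister form $\phi$, and let $Q$ and $\Phi$ be the projective quadrics over $k$ given by $q=0$ and $\phi=0$. Then \[ \mathrm{GI}^{\mathrm{tr}}_Q=\mathrm{GI}^{\mathrm{tr}}_\Phi \] (for any choices of the functionals), and \[ [D(q)^2]=[D(\phi)^2]=D(\phi). \] -/

import Mathlib

open CategoryTheory AlgebraicGeometry
open scoped Pointwise DirectSum

universe u

noncomputable section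

/-! ### Regular quadratic forms and the Grothendieck-Witt group -/

namespace QuadraticForms

/-- A quadratic form is regular if its polar form `b(x, y) = q(x + y) - q(x) - q(y)` has trivial
radical.  (In characteristic different from two, `b` is twice the symmetric bilinear form attached
to `q`, so this is the usual notion.) -/
def IsRegular {F V : Type*} [Field F] [AddCommGroup V] [Module F V]
    (q : QuadraticForm F V) : Prop :=
  ∀ x : V, (∀ y : V, QuadraticMap.polar q x y = 0) → x = 0

/-- A finite-dimensional vector space over `F` with a regular quadratic form on it. -/
structure RegularSpace (F : Type u) [Field F] : Type (u + 1) where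
  /-- the underlying vector space -/
  carrier : Type u
  [addCommGroup : AddCommGroup carrier]
  [module : Module F carrier]
  [finite : Module.Finite F carrier]
  /-- the quadratic form -/
  form : QuadraticForm F carrier
  regular : IsRegular form

attribute [instance] RegularSpace.addCommGroup RegularSpace.module RegularSpace.finite

/-- Isometry of regular quadratic spaces. -/
instance isometrySetoid (F : Type u) [Field F] : Setoid (RegularSpace F) where
  r V W := V.form.Equivalent W.form
  iseqv := ⟨fun _ => QuadraticMap.Equivalent.refl _, fun h => h.symm, fun h h' => h.trans h'⟩

/-- The isometry classes of regular quadratic forms over `F`. -/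
def IsometryClass (F : Type u) [Field F] : Type (u + 1) :=
  Quotient (isometrySetoid F)

section Sum

variable {F : Type u} [Field F]

theorem isRegular_prod {V W : Type*} [AddCommGroup V] [Module F V] [AddCommGroup W] [Module F W]
    {q : QuadraticForm F V} {r : QuadraticForm F W} (hq : IsRegular q) (hr : IsRegular r) :
    IsRegular (q.prod r) := by
  rintro ⟨v, w⟩ h
  refine Prod.ext (hq v fun y => ?_) (hr w fun y => ?_)
  · simpa [QuadraticMap.polar_prod, QuadraticMap.polar_zero_right] using h (y, 0)
  · simpa [QuadraticMap.polar_prod, QuadraticMap.polar_zero_right] using h (0, y)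

/-- The orthogonal sum of two regular quadratic spaces. -/
def RegularSpace.sum (V W : RegularSpace F) : RegularSpace F where
  carrier := V.carrier × W.carrier
  form := V.form.prod W.form
  regular := isRegular_prod V.regular W.regular

/-- The zero quadratic space. -/
def RegularSpace.zero (F : Type u) [Field F] : RegularSpace F where
  carrier := PUnit.{u + 1}
  form := 0
  regular := fun _ _ => rfl

/-- The orthogonal sum of isometry classes. -/
instance : Add (IsometryClass F) where
  add := Quotient.map₂ RegularSpace.sum fun _ _ h _ _ h' => QuadraticMap.Equivalent.prod h h'

/-- The class of the zero space. -/
instance : Zero (IsometryClass F) where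
  zero := Quotient.mk _ (RegularSpace.zero F)

/-- The isometry classes form a commutative monoid under orthogonal sum. -/
instance : AddCommMonoid (IsometryClass F) where
  nsmul := nsmulRec
  add_assoc a b c := by
    induction a using Quotient.inductionOn with | _ U => ?_
    induction b using Quotient.inductionOn with | _ V => ?_
    induction c using Quotient.inductionOn with | _ W => ?_
    exact Quotient.sound ⟨⟨LinearEquiv.prodAssoc F U.carrier V.carrier W.carrier,
      fun x => (add_assoc (U.form x.1.1) (V.form x.1.2) (W.form x.2)).symm⟩⟩
  zero_add a := by
    induction a using Quotient.inductionOn with | _ U => ?_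
    exact Quotient.sound ⟨⟨(LinearEquiv.uniqueProd : (PUnit.{u + 1} × U.carrier) ≃ₗ[F] U.carrier),
      fun x => (zero_add (U.form x.2)).symm⟩⟩
  add_zero a := by
    induction a using Quotient.inductionOn with | _ U => ?_
    exact Quotient.sound ⟨⟨(LinearEquiv.prodUnique : (U.carrier × PUnit.{u + 1}) ≃ₗ[F] U.carrier),
      fun x => (add_zero (U.form x.1)).symm⟩⟩
  add_comm a b := by
    induction a using Quotient.inductionOn with | _ U => ?_
    induction b using Quotient.inductionOn with | _ V => ?_
    exact Quotient.sound ⟨QuadraticMap.IsometryEquiv.prodComm U.form V.form⟩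

end Sum

/-- The additive group of the Grothendieck-Witt ring of `F`: the Grothendieck group of the monoid
of isometry classes of regular quadratic forms under orthogonal sum. -/
abbrev GW (F : Type u) [Field F] : Type (u + 1) :=
  Algebra.GrothendieckAddGroup (IsometryClass F)

/-! ### Scharlau's transfer -/

section Transfer

variable {F E : Type u} [Field F] [Field E] [Algebra F E]

/-- The quadratic form `x ↦ s (q x)` over `F`, for a quadratic form `q` over `E` and an `F`-linear
functional `s` on `E`. -/
def transferForm (s : E →ₗ[F] F) {V : Type*} [AddCommGroup V] [Module E V] [Module F V]
    [IsScalarTower F E V] (q : QuadraticForm E V) : QuadraticForm F V :=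
  s.compQuadraticMap' q

theorem isRegular_transferForm {s : E →ₗ[F] F} (hs : s ≠ 0) {V : Type*} [AddCommGroup V]
    [Module E V] [Module F V] [IsScalarTower F E V] {q : QuadraticForm E V} (hq : IsRegular q) :
    IsRegular (transferForm s q) := by
  intro x hx
  refine hq x fun y => ?_
  by_contra hne
  refine hs (LinearMap.ext fun c => ?_)
  have h := hx ((c / QuadraticMap.polar q x y) • y)
  rwa [transferForm, LinearMap.compQuadraticMap_polar, QuadraticMap.polar_smul_right, smul_eq_mul,
    div_mul_cancel₀ _ hne] at h

variable [Module.Finite F E]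

/-- The transfer of a regular quadratic space: the underlying `F`-vector space, with the form
`x ↦ s (q x)`. -/
def RegularSpace.transfer (s : E →ₗ[F] F) (hs : s ≠ 0) (V : RegularSpace E) : RegularSpace F :=
  letI : Module F V.carrier := Module.compHom V.carrier (algebraMap F E)
  haveI : IsScalarTower F E V.carrier := IsScalarTower.of_algebraMap_smul fun _ _ => rfl
  { carrier := V.carrier
    finite := Module.Finite.trans E V.carrier
    form := transferForm s V.form
    regular := isRegular_transferForm hs V.regular }

/-- The transfer on isometry classes. -/
def transferClass (s : E →ₗ[F] F) (hs : s ≠ 0) : IsometryClass E →+ IsometryClass F where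
  toFun := Quotient.map (RegularSpace.transfer s hs) fun _ _ h =>
    h.elim fun e => ⟨⟨{ e.toLinearEquiv with
      map_smul' := fun c x => e.toLinearEquiv.map_smul (algebraMap F E c) x },
      fun x => congrArg s (e.map_app x)⟩⟩
  map_zero' := Quotient.sound ⟨⟨{ Equiv.refl PUnit.{u + 1} with
      map_add' := fun _ _ => rfl
      map_smul' := fun _ _ => rfl }, fun _ => (map_zero s).symm⟩⟩
  map_add' a b := by
    induction a using Quotient.inductionOn with | _ U => ?_
    induction b using Quotient.inductionOn with | _ V => ?_
    exact Quotient.sound ⟨⟨{ Equiv.refl (U.carrier × V.carrier) with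
        map_add' := fun _ _ => rfl
        map_smul' := fun _ _ => rfl },
      fun x => (map_add s (U.form x.1) (V.form x.2)).symm⟩⟩

/-- Scharlau's transfer `s_* : GW(E) → GW(F)` along a nonzero `F`-linear functional `s : E → F`:
the additive map sending the class of `q` to the class of the form `x ↦ s (q x)`; in particular
`⟨a⟩` is sent to the form `x ↦ s (a x ^ 2)` on `E`. -/
def scharlauTransfer (s : E →ₗ[F] F) (hs : s ≠ 0) : GW E →+ GW F :=
  Algebra.GrothendieckAddGroup.lift
    (Algebra.GrothendieckAddGroup.of.comp (transferClass s hs))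

end Transfer

/-! ### The transfer ideal of a variety -/

section TransferIdeal

variable (k : Type u) [Field k] (X : Scheme.{u}) [X.Over (Spec (.of k))]

/-- The residue field `k(x)` of a point of a `k`-scheme as an extension of `k`. -/
instance residueFieldAlgebra (x : X) : Algebra k (X.residueField x) :=
  (Spec.preimage (X.fromSpecResidueField x ≫ X ↘ Spec (.of k))).hom.toAlgebra

/-- The residue fields of the closed points of a `k`-scheme locally of finite type are finite
over `k`. -/
instance finite_residueField [LocallyOfFiniteType (X ↘ Spec (.of k))] (x : closedPoints X) :
    Module.Finite k (X.residueField x.1) := by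
  have hx : IsClosed {x.1} := x.2
  have : IsFinite (X.fromSpecResidueField x.1 ≫ X ↘ Spec (.of k)) := by
    rw [isClosed_singleton_iff_isClosedImmersion] at hx
    rw [isFinite_iff_locallyOfFiniteType_of_jacobsonSpace]
    infer_instance
  rw [← Spec.map_preimage (X.fromSpecResidueField x.1 ≫ X ↘ Spec (.of k)),
    IsFinite.SpecMap_iff] at this
  exact this

/-- A choice of a nonzero `k`-linear functional `s_x : k(x) → k` for every closed point `x`. -/
structure FunctionalChoice where
  /-- the functional `s_x` -/
  toFun (x : closedPoints X) : X.residueField x.1 →ₗ[k] k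
  ne_zero (x : closedPoints X) : toFun x ≠ 0

instance : Nonempty (FunctionalChoice k X) := by
  have h (x : closedPoints X) : ∃ f : X.residueField x.1 →ₗ[k] k, f ≠ 0 :=
    let ⟨f, hf⟩ := Module.Projective.exists_dual_ne_zero k (one_ne_zero (α := X.residueField x.1))
    ⟨f, fun h0 => hf (by rw [h0, LinearMap.zero_apply])⟩
  choose f hf using h
  exact ⟨⟨f, hf⟩⟩

/-- The transfer ideal of a `k`-scheme `X`, as a subgroup of `GW(k)`: the sum over all closed points
`x` of `X` of the images of the transfers `(s_x)_* : GW(k(x)) → GW(k)`. -/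
def transferIdeal [LocallyOfFiniteType (X ↘ Spec (.of k))] (s : FunctionalChoice k X) :
    AddSubgroup (GW k) :=
  ⨆ x : closedPoints X, (scharlauTransfer (s.toFun x) (s.ne_zero x)).range

end TransferIdeal

/-! ### Projective quadrics -/

section QuotientGrading

variable {k A : Type u} [Field k] [CommRing A] [Algebra k A]
  (𝒜 : ℕ → Submodule k A) [GradedAlgebra 𝒜] (I : HomogeneousIdeal 𝒜)

/-- The grading of `A ⧸ I` by the images of the graded pieces of `A`, for a homogeneous ideal
`I`. -/
def quotientGrading (i : ℕ) : Submodule k (A ⧸ I.toIdeal) :=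
  (𝒜 i).map (Ideal.Quotient.mkₐ k I.toIdeal).toLinearMap

/-- The map `A → ⨁ (A ⧸ I)_i` sending `a` to the classes of its homogeneous components. -/
def quotientComponents : A →ₗ[k] ⨁ i, quotientGrading 𝒜 I i :=
  (DirectSum.lmap fun i =>
      ((Ideal.Quotient.mkₐ k I.toIdeal).toLinearMap.submoduleMap (𝒜 i) :
        𝒜 i →ₗ[k] quotientGrading 𝒜 I i)) ∘ₗ
    (DirectSum.decomposeLinearEquiv 𝒜).toLinearMap

/-- The decomposition of a class into the classes of the homogeneous components. -/
def quotientDecompose : A ⧸ I.toIdeal →+ ⨁ i, quotientGrading 𝒜 I i :=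
  QuotientAddGroup.lift I.toIdeal.toAddSubgroup (quotientComponents 𝒜 I).toAddMonoidHom (by
    intro a ha
    refine DFinsupp.ext fun i => Subtype.ext ?_
    exact Ideal.Quotient.eq_zero_iff_mem.mpr (I.isHomogeneous i ha))

theorem quotientDecompose_mk {i : ℕ} {a : A} (ha : a ∈ 𝒜 i) :
    quotientDecompose 𝒜 I (Ideal.Quotient.mk I.toIdeal a) =
      DirectSum.of (fun i => quotientGrading 𝒜 I i) i
        ⟨Ideal.Quotient.mk I.toIdeal a, a, ha, rfl⟩ := by
  change DirectSum.lmap _ (DirectSum.decompose 𝒜 a) = _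
  rw [DirectSum.decompose_of_mem 𝒜 ha, DirectSum.lmap_of]
  rfl

instance quotientGradedAlgebra : GradedAlgebra (quotientGrading 𝒜 I) where
  one_mem := ⟨1, SetLike.GradedOne.one_mem, map_one (Ideal.Quotient.mkₐ k I.toIdeal)⟩
  mul_mem := by
    rintro i j _ _ ⟨a, ha, rfl⟩ ⟨b, hb, rfl⟩
    exact ⟨a * b, SetLike.GradedMul.mul_mem ha hb, map_mul (Ideal.Quotient.mkₐ k I.toIdeal) a b⟩
  decompose' := quotientDecompose 𝒜 I
  left_inv := by
    intro x
    obtain ⟨a, rfl⟩ := Ideal.Quotient.mk_surjective x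
    induction a using DirectSum.Decomposition.inductionOn 𝒜 with
    | zero => simp
    | @homogeneous i m => rw [quotientDecompose_mk 𝒜 I m.2, DirectSum.coeAddMonoidHom_of]
    | add a b ha hb => rw [map_add, map_add, map_add, ha, hb]
  right_inv := by
    intro x
    induction x using DirectSum.induction_on with
    | zero => simp
    | of i x =>
      obtain ⟨_, m, hm, rfl⟩ := x
      rw [DirectSum.coeAddMonoidHom_of]
      exact quotientDecompose_mk 𝒜 I hm
    | add a b ha hb => rw [map_add, map_add, ha, hb]

/-- The structure morphism `Proj A → Spec k` for a graded `k`-algebra `A`. -/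
instance projOver : (Proj 𝒜).Over (Spec (.of k)) where
  hom := Proj.toSpecZero 𝒜 ≫ Spec.map (CommRingCat.ofHom (algebraMap k (𝒜 0)))

/-- `Proj A` is of finite type over `k` if `A` is finitely generated with `A₀` spanned by `1`. -/
theorem locallyOfFiniteType_proj [Algebra.FiniteType k A]
    (h0 : Function.Surjective (algebraMap k (𝒜 0))) :
    LocallyOfFiniteType (Proj 𝒜 ↘ Spec (.of k)) := by
  have : IsScalarTower k (𝒜 0) A := ⟨fun c x y => smul_mul_assoc c (x : A) y⟩
  have : Algebra.FiniteType (𝒜 0) A := Algebra.FiniteType.of_restrictScalars_finiteType k (𝒜 0) A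
  have : LocallyOfFiniteType (Spec.map (CommRingCat.ofHom (algebraMap k (𝒜 0)))) := by
    rw [HasRingHomProperty.Spec_iff (P := @LocallyOfFiniteType)]
    exact RingHom.FiniteType.of_surjective _ h0
  change LocallyOfFiniteType
    (Proj.toSpecZero 𝒜 ≫ Spec.map (CommRingCat.ofHom (algebraMap k (𝒜 0))))
  infer_instance

end QuotientGrading

section Quadric

variable {k : Type u} [Field k] [Invertible (2 : k)] {m : ℕ}

/-- The homogeneous polynomial `∑ A_{ij} x_i x_j` of a quadratic form in `m` variables, where `A`
is its symmetric matrix. -/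
def formPolynomial (q : QuadraticForm k (Fin m → k)) : MvPolynomial (Fin m) k :=
  ∑ i, ∑ j, MvPolynomial.C (q.toMatrix' i j) * (MvPolynomial.X i * MvPolynomial.X j)

theorem isHomogeneous_formPolynomial (q : QuadraticForm k (Fin m → k)) :
    (formPolynomial q).IsHomogeneous 2 :=
  MvPolynomial.IsHomogeneous.sum _ _ _ fun i _ => MvPolynomial.IsHomogeneous.sum _ _ _ fun j _ =>
    zero_add 2 ▸ (MvPolynomial.isHomogeneous_C _ _).mul
      ((MvPolynomial.isHomogeneous_X k i).mul (MvPolynomial.isHomogeneous_X k j))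

attribute [instance] MvPolynomial.gradedAlgebra

/-- The homogeneous ideal generated by the polynomial of `q`. -/
def quadricIdeal (q : QuadraticForm k (Fin m → k)) :
    HomogeneousIdeal (MvPolynomial.homogeneousSubmodule (Fin m) k) where
  toSubmodule := Ideal.span {formPolynomial q}
  is_homogeneous' := Ideal.homogeneous_span _ _ (by
    rintro _ rfl
    exact ⟨2, isHomogeneous_formPolynomial q⟩)

/-- The grading of the homogeneous coordinate ring `k[x_1, …, x_m] / (q)` by degree. -/
abbrev quadricGrading (q : QuadraticForm k (Fin m → k)) :=
  quotientGrading (MvPolynomial.homogeneousSubmodule (Fin m) k) (quadricIdeal q)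

/-- The projective quadric `q = 0` in `ℙ^{m-1}`, that is `Proj (k[x_1, …, x_m] / (q))`. -/
abbrev projectiveQuadric (q : QuadraticForm k (Fin m → k)) : Scheme.{u} :=
  Proj (quadricGrading q)

instance locallyOfFiniteType_projectiveQuadric (q : QuadraticForm k (Fin m → k)) :
    LocallyOfFiniteType (projectiveQuadric q ↘ Spec (.of k)) := by
  refine locallyOfFiniteType_proj _ ?_
  rintro ⟨_, p, hp, rfl⟩
  have hp' : p.IsHomogeneous 0 := hp
  rw [← MvPolynomial.totalDegree_zero_iff_isHomogeneous,
    MvPolynomial.totalDegree_eq_zero_iff_eq_C] at hp'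
  exact ⟨p.coeff 0, Subtype.ext (congrArg (Ideal.Quotient.mk _) hp'.symm)⟩

end Quadric

/-! ### Values of quadratic forms, Pfister forms and Pfister neighbors -/

section Pfister

variable {k : Type u} [Field k]

/-- `D(q)`, the set of nonzero values of `q`. -/
def valueSet {V : Type*} [AddCommGroup V] [Module k V] (q : QuadraticForm k V) : Set kˣ :=
  {a | ∃ v, q v = a}

/-- The `n`-fold Pfister form `⟨⟨a_1, …, a_n⟩⟩ = ∏ ⟨1, -a_i⟩`: the diagonal form of dimension `2 ^ n`
whose coefficients are all the products `c_1 ⋯ c_n` with `c_i ∈ {1, -a_i}`. -/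
def pfisterForm {n : ℕ} (a : Fin n → kˣ) : QuadraticForm k ((Fin n → Fin 2) → k) :=
  QuadraticMap.weightedSumSquares k fun e : Fin n → Fin 2 =>
    ∏ i, (![1, -(a i : k)] : Fin 2 → k) (e i)

/-- `φ` is isometric to an `n`-fold Pfister form. -/
def IsPfisterForm (n : ℕ) {V : Type*} [AddCommGroup V] [Module k V] (φ : QuadraticForm k V) :
    Prop :=
  ∃ a : Fin n → kˣ, φ.Equivalent (pfisterForm a)

/-- `q` is isometric to the restriction of `φ` to a subspace. -/
def IsSubform {V W : Type*} [AddCommGroup V] [Module k V] [AddCommGroup W] [Module k W]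
    (q : QuadraticForm k V) (φ : QuadraticForm k W) : Prop :=
  ∃ f : q →qᵢ φ, Function.Injective f

/-- `q` is a Pfister neighbor with associated Pfister form `φ`: `q` is regular, `φ` is an `n`-fold
Pfister form with `2 ^ (n - 1) < dim q` (as rational numbers), and `⟨c⟩ · q` is a subform of `φ` for
some `c ∈ kˣ`. -/
def IsPfisterNeighbor {V W : Type*} [AddCommGroup V] [Module k V] [AddCommGroup W] [Module k W]
    (q : QuadraticForm k V) (φ : QuadraticForm k W) : Prop :=
  IsRegular q ∧ ∃ n : ℕ, IsPfisterForm n φ ∧ 2 ^ n < 2 * Module.finrank k V ∧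
    ∃ c : kˣ, IsSubform ((c : k) • q) φ

end Pfister

end QuadraticForms

end

/-! Two properties of Pfister forms carry everything, both proved by induction along `P ↦ P ⊥ -aP`:
they are round (`isRound_pfisterForm`), and once isotropic they contain a totally isotropic subspace
of half the dimension (`isHyperbolicOfIsotropic_pfisterForm`). A neighbor fills more than half of
`φ`, so it meets any subspace of half the dimension.

Transfer ideals: over any extension `E`, the image of `q` in `φ` meets a half-dimensional isotropic
subspace when `φ` is isotropic, so `q` and `φ` become isotropic over the same fields
(`IsPfisterNeighbor.isotropic_iff`). A quadric always has a point over the residue field of each of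
its points, so for each closed point `x` of one quadric there is a closed point `y` of the other
with `k(y)` embedded in `k(x)` over `k`. Transitivity of transfers then puts the image from `k(x)`
inside the image from `k(y)`, whatever the functionals (`range_scharlauTransfer_le`).

Values: roundness makes `D(φ)` a group. For `d ∈ D(φ)` and anisotropic `q`, the copy of `q` in `φ`
meets its image under a similitude of factor `d`, which exhibits `d` as a quotient of two values of
`q` (`IsPfisterNeighbor.closure_valueSet_eq`). -/

namespace QuadraticForms

/-! ### Round forms and totally isotropic subspaces -/

section Round

variable {F V W : Type*} [Field F] [AddCommGroup V] [Module F V] [AddCommGroup W] [Module F W]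

/-- A quadratic form is round if each nonzero value is the factor of a similitude. -/
def IsRound (P : QuadraticForm F V) : Prop :=
  ∀ v, P v ≠ 0 → ∃ σ : V →ₗ[F] V, ∀ x, P (σ x) = P v * P x

/-- An isotropic form has a totally isotropic subspace of half the dimension. -/
def IsHyperbolicOfIsotropic (P : QuadraticForm F V) : Prop :=
  (∃ v, v ≠ 0 ∧ P v = 0) →
    ∃ L : Submodule F V, (∀ w ∈ L, P w = 0) ∧ 2 * Module.finrank F L = Module.finrank F V

theorem IsRound.of_equivalent {P : QuadraticForm F V} {R : QuadraticForm F W}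
    (hP : IsRound P) (h : P.Equivalent R) : IsRound R := by
  obtain ⟨e⟩ := h
  intro w hw
  have h0 : P (e.symm w) = R w := e.symm.map_app w
  obtain ⟨σ, hσ⟩ := hP (e.symm w) (by rwa [h0])
  refine ⟨e.toLinearEquiv.toLinearMap ∘ₗ σ ∘ₗ e.symm.toLinearEquiv.toLinearMap, fun x => ?_⟩
  have h1 : P (e.symm x) = R x := e.symm.map_app x
  rw [← h0, ← h1, ← hσ]
  exact e.map_app _

theorem IsHyperbolicOfIsotropic.of_equivalent {P : QuadraticForm F V} {R : QuadraticForm F W}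
    (hP : IsHyperbolicOfIsotropic P) (h : P.Equivalent R) : IsHyperbolicOfIsotropic R := by
  obtain ⟨e⟩ := h
  rintro ⟨w, hw, hw0⟩
  obtain ⟨L, hL, hd⟩ := hP ⟨e.symm.toLinearEquiv w, by simpa using hw, (e.symm.map_app w).trans hw0⟩
  refine ⟨L.map e.toLinearEquiv.toLinearMap, ?_, ?_⟩
  · rintro _ ⟨x, hx, rfl⟩
    exact (e.map_app x).trans (hL x hx)
  · rw [← e.toLinearEquiv.finrank_eq, ← hd]
    congr 1
    exact LinearEquiv.finrank_map_eq e.toLinearEquiv L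

/-- The form `P ⊥ -aP`, that is `⟨⟨a⟩⟩ ⊗ P`. -/
def pfisterDouble (a : F) (P : QuadraticForm F V) : QuadraticForm F (V × V) :=
  P.prod (-a • P)

theorem pfisterDouble_apply (a : F) (P : QuadraticForm F V) (x y : V) :
    pfisterDouble a P (x, y) = P x - a * P y := by
  simp [pfisterDouble, sub_eq_add_neg]

/-- A nonzero value is `c - ad` with `c = P u`, `d = P v`. Similitudes of `P` with factors `c` and
`d` are assembled into a block operator on `V × V`; the cases `d = 0` and `c = 0` need separate
blocks because the generic one divides by both. -/
theorem IsRound.pfisterDouble {P : QuadraticForm F V} (hP : IsRound P) (a : F) :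
    IsRound (pfisterDouble a P) := by
  rintro ⟨u, v⟩ h
  rw [pfisterDouble_apply] at h
  by_cases hv : P v = 0
  · obtain ⟨σ, hσ⟩ := hP u (by simpa [hv] using h)
    refine ⟨σ.prodMap σ, fun ⟨x, y⟩ => ?_⟩
    simp only [LinearMap.prodMap_apply, pfisterDouble_apply, hσ, hv]
    ring
  obtain ⟨τ, hτ⟩ := hP v hv
  by_cases hu : P u = 0
  · refine ⟨(a • τ ∘ₗ LinearMap.snd F V V).prod (τ ∘ₗ LinearMap.fst F V V), fun ⟨x, y⟩ => ?_⟩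
    change QuadraticForms.pfisterDouble a P (a • τ y, τ x) = _
    simp only [pfisterDouble_apply, QuadraticMap.map_smul, smul_eq_mul, hτ, hu]
    ring
  obtain ⟨σ, hσ⟩ := hP u hu
  let ρ : V →ₗ[F] V := (P u)⁻¹ • σ ∘ₗ τ
  have hρ (x : V) : P (ρ x) = P v / P u * P x := by
    simp only [ρ, LinearMap.smul_apply, LinearMap.comp_apply, QuadraticMap.map_smul, smul_eq_mul,
      hσ, hτ]
    field_simp
  let ρ' : V →ₗ[F] V := (P v)⁻¹ • σ ∘ₗ τ
  have hρ' (x : V) : P (ρ' x) = P u / P v * P x := by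
    simp only [ρ', LinearMap.smul_apply, LinearMap.comp_apply, QuadraticMap.map_smul, smul_eq_mul,
      hσ, hτ]
    field_simp
  -- Put `e = a * P v / P u` and `z = ρ' y`, so that `P x - a * P y = P x - e * P z`. The map `(x,
  -- z) ↦ (x + e z, x + z)` is multiplication by `1 + √e`, of norm `1 - e`; the polar terms cancel
  -- as they do for norms. Then `σ` supplies the factor `P u`, and `ρ` turns the coefficient `e`
  -- back into `a`.
  refine ⟨(σ ∘ₗ (LinearMap.fst F V V + (a * (P v / P u)) • ρ' ∘ₗ LinearMap.snd F V V)).prod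
    (ρ ∘ₗ σ ∘ₗ (LinearMap.fst F V V + ρ' ∘ₗ LinearMap.snd F V V)), fun ⟨x, y⟩ => ?_⟩
  change QuadraticForms.pfisterDouble a P
    (σ (x + (a * (P v / P u)) • ρ' y), ρ (σ (x + ρ' y))) = _
  simp only [pfisterDouble_apply, hσ, hρ, hρ', QuadraticMap.map_add P, QuadraticMap.map_smul,
    QuadraticMap.polar_smul_right, smul_eq_mul]
  field_simp
  ring

/-- An isotropic vector `(u, v)` gives `P u = a * P v`. If `P v = 0`, then `P` is already isotropic
and `L × L` works. Otherwise `a` is a quotient of values of `P`, hence a similitude factor by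
roundness, and the graph of such a similitude is totally isotropic. -/
theorem IsHyperbolicOfIsotropic.pfisterDouble [Module.Finite F V] {P : QuadraticForm F V}
    (hP : IsHyperbolicOfIsotropic P) (hR : IsRound P) (a : F) (ha : a ≠ 0) :
    IsHyperbolicOfIsotropic (pfisterDouble a P) := by
  rintro ⟨⟨u, v⟩, h0, h⟩
  rw [pfisterDouble_apply, sub_eq_zero] at h
  by_cases hv : P v = 0
  · have hu : P u = 0 := by rw [h, hv, mul_zero]
    obtain ⟨L, hL, hd⟩ := hP (by
      by_cases hu0 : u = 0
      · exact ⟨v, fun hv0 => h0 (by simp [hu0, hv0]), hv⟩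
      · exact ⟨u, hu0, hu⟩)
    refine ⟨L.prod L, ?_, ?_⟩
    · rintro ⟨x, y⟩ ⟨hx, hy⟩
      rw [pfisterDouble_apply, hL x hx, hL y hy]
      ring
    · have hLL : L.prod L = LinearMap.range (L.subtype.prodMap L.subtype) := by
        rw [LinearMap.range_prodMap, Submodule.range_subtype]
      rw [hLL, LinearMap.finrank_range_of_inj
        (Function.Injective.prodMap L.injective_subtype L.injective_subtype),
        Module.finrank_prod, Module.finrank_prod, ← hd]
      ring
  obtain ⟨σ, hσ⟩ := hR u (by rw [h]; exact mul_ne_zero ha hv)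
  obtain ⟨τ, hτ⟩ := hR v hv
  let ρ : V →ₗ[F] V := (P v)⁻¹ • σ ∘ₗ τ
  have hρ (x : V) : P (ρ x) = a * P x := by
    simp only [ρ, LinearMap.smul_apply, LinearMap.comp_apply, QuadraticMap.map_smul, smul_eq_mul,
      hσ, hτ, h]
    field_simp
  refine ⟨LinearMap.range (ρ.prod LinearMap.id), ?_, ?_⟩
  · rintro _ ⟨x, rfl⟩
    change QuadraticForms.pfisterDouble a P (ρ x, x) = 0
    rw [pfisterDouble_apply, hρ, sub_self]
  · rw [LinearMap.finrank_range_of_inj fun x y hxy => congrArg Prod.snd hxy,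
      Module.finrank_prod, two_mul]

/-- The recursive description of Pfister forms. -/
theorem equivalent_pfisterForm_succ {n : ℕ} (a : Fin (n + 1) → Fˣ) :
    (pfisterDouble (a 0 : F) (pfisterForm (Fin.tail a))).Equivalent (pfisterForm a) := by
  let c : Fin 2 × (Fin n → Fin 2) ≃ (Fin (n + 1) → Fin 2) := Fin.consEquiv fun _ => Fin 2
  let e : (((Fin n → Fin 2) → F) × ((Fin n → Fin 2) → F)) ≃ₗ[F] ((Fin (n + 1) → Fin 2) → F) :=
    { toFun := fun x i => (![x.1, x.2] (c.symm i).1) (c.symm i).2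
      invFun := fun y => (fun i => y (c (0, i)), fun i => y (c (1, i)))
      map_add' := fun x y => by
        funext i
        rcases hc : (c.symm i).1 with ⟨_ | _ | j, hj⟩
        · simp [hc]
        · simp [hc]
        · omega
      map_smul' := fun t x => by
        funext i
        rcases hc : (c.symm i).1 with ⟨_ | _ | j, hj⟩
        · simp [hc]
        · simp [hc]
        · omega
      left_inv := fun x => by simp
      right_inv := fun y => by
        funext i
        obtain ⟨⟨j, i⟩, rfl⟩ := c.surjective i
        fin_cases j <;> simp }
  refine ⟨⟨e, fun ⟨x, y⟩ => ?_⟩⟩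
  rw [pfisterDouble_apply, pfisterForm, pfisterForm, QuadraticMap.weightedSumSquares_apply,
    QuadraticMap.weightedSumSquares_apply, QuadraticMap.weightedSumSquares_apply,
    ← c.sum_comp, Fintype.sum_prod_type, Fin.sum_univ_two, Finset.mul_sum, sub_eq_add_neg,
    ← Finset.sum_neg_distrib]
  congr 1 <;> refine Finset.sum_congr rfl fun i _ => ?_
  · simp [e, c, Fin.prod_univ_succ, Fin.consEquiv, Fin.tail]
  · simp [e, c, Fin.prod_univ_succ, Fin.consEquiv, Fin.tail]
    ring

theorem pfisterForm_zero_apply (a : Fin 0 → Fˣ) (v : (Fin 0 → Fin 2) → F) :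
    pfisterForm a v = v default * v default := by
  rw [pfisterForm, QuadraticMap.weightedSumSquares_apply, Fintype.sum_unique]
  simp only [Finset.univ_eq_empty, Finset.prod_empty, one_smul]
  exact congrArg (fun i => v i * v i) (Subsingleton.elim _ _)

theorem isRound_pfisterForm {n : ℕ} (a : Fin n → Fˣ) : IsRound (pfisterForm a) := by
  induction n with
  | zero =>
    refine fun v _ => ⟨v default • LinearMap.id, fun x => ?_⟩
    simp only [pfisterForm_zero_apply, LinearMap.smul_apply, LinearMap.id_apply, Pi.smul_apply,
      smul_eq_mul]
    ring
  | succ n ih => exact ((ih _).pfisterDouble _).of_equivalent (equivalent_pfisterForm_succ a)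

theorem isHyperbolicOfIsotropic_pfisterForm {n : ℕ} (a : Fin n → Fˣ) :
    IsHyperbolicOfIsotropic (pfisterForm a) := by
  induction n with
  | zero =>
    rintro ⟨v, hv, h⟩
    rw [pfisterForm_zero_apply, mul_self_eq_zero] at h
    exact absurd (funext fun i => by rw [Subsingleton.elim i default, h, Pi.zero_apply]) hv
  | succ n ih =>
    exact ((ih _).pfisterDouble (isRound_pfisterForm _) _ (a 0).ne_zero).of_equivalent
      (equivalent_pfisterForm_succ a)

theorem exists_pfisterForm_eq_one {n : ℕ} (a : Fin n → Fˣ) : ∃ v, pfisterForm a v = 1 := by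
  refine ⟨Pi.single 0 1, ?_⟩
  rw [pfisterForm, QuadraticMap.weightedSumSquares_apply, Finset.sum_eq_single 0]
  · simp
  · intro i _ hi
    simp [hi]
  · simp

end Round

/-! ### Value sets -/

section Values

variable {F V W : Type*} [Field F] [AddCommGroup V] [Module F V] [AddCommGroup W] [Module F W]

theorem IsPfisterForm.isRound {n : ℕ} {φ : QuadraticForm F W} (h : IsPfisterForm n φ) :
    IsRound φ :=
  let ⟨a, ha⟩ := h
  (isRound_pfisterForm a).of_equivalent ha.symm

theorem IsPfisterForm.finrank_eq {n : ℕ} {φ : QuadraticForm F W} (h : IsPfisterForm n φ) :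
    Module.finrank F W = 2 ^ n := by
  obtain ⟨a, ⟨e⟩⟩ := h
  rw [e.toLinearEquiv.finrank_eq, Module.finrank_fintype_fun_eq_card]
  simp

theorem IsPfisterForm.one_mem_valueSet {n : ℕ} {φ : QuadraticForm F W} (h : IsPfisterForm n φ) :
    1 ∈ valueSet φ := by
  obtain ⟨a, ⟨e⟩⟩ := h
  obtain ⟨v, hv⟩ := exists_pfisterForm_eq_one a
  exact ⟨e.symm v, (e.symm.map_app v).trans hv⟩

theorem mul_sq_mem_valueSet {φ : QuadraticForm F W} {a : Fˣ} (ha : a ∈ valueSet φ) (c : Fˣ) :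
    c * c * a ∈ valueSet φ := by
  obtain ⟨v, hv⟩ := ha
  exact ⟨(c : F) • v, by simp [QuadraticMap.map_smul, hv]⟩

theorem IsRound.mul_mem_valueSet {φ : QuadraticForm F W} (h : IsRound φ) {a b : Fˣ}
    (ha : a ∈ valueSet φ) (hb : b ∈ valueSet φ) : a * b ∈ valueSet φ := by
  obtain ⟨v, hv⟩ := ha
  obtain ⟨w, hw⟩ := hb
  obtain ⟨σ, hσ⟩ := h v (by rw [hv]; exact a.ne_zero)
  exact ⟨σ w, by rw [hσ, hv, hw, Units.val_mul]⟩

/-- The values of a Pfister form form a group. -/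
def IsPfisterForm.valueSubgroup {n : ℕ} {φ : QuadraticForm F W} (h : IsPfisterForm n φ) :
    Subgroup Fˣ where
  carrier := valueSet φ
  mul_mem' := h.isRound.mul_mem_valueSet
  one_mem' := h.one_mem_valueSet
  inv_mem' := fun {a} ha => by
    have := mul_sq_mem_valueSet ha a⁻¹
    rwa [mul_assoc, inv_mul_cancel, mul_one] at this

theorem IsPfisterForm.closure_valueSet {n : ℕ} {φ : QuadraticForm F W} (h : IsPfisterForm n φ) :
    Subgroup.closure (valueSet φ * valueSet φ) = h.valueSubgroup := by
  refine le_antisymm ((Subgroup.closure_le _).mpr ?_) fun a ha => ?_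
  · rintro _ ⟨a, ha, b, hb, rfl⟩
    exact h.valueSubgroup.mul_mem ha hb
  · exact Subgroup.subset_closure ⟨a, ha, 1, h.one_mem_valueSet, mul_one a⟩

/-- A regular isotropic form is universal. -/
theorem IsRegular.valueSet_eq_univ {q : QuadraticForm F V} (hq : IsRegular q) {v : V}
    (hv : v ≠ 0) (h : q v = 0) : valueSet q = Set.univ := by
  refine Set.eq_univ_of_forall fun a => ?_
  obtain ⟨w, hw⟩ : ∃ w, QuadraticMap.polar q v w ≠ 0 := by
    by_contra! hc
    exact hv (hq v hc)
  -- Since `q v = 0`, the value `q (t v + w)` is affine in `t` with nonzero slope; solve for `a`.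
  refine ⟨((a - q w) / QuadraticMap.polar q v w) • v + w, ?_⟩
  rw [QuadraticMap.map_add q, QuadraticMap.map_smul, QuadraticMap.polar_smul_left, h]
  simp only [smul_eq_mul]
  field_simp
  ring

/-- Two injective linear maps into a space of dimension less than the sum of the dimensions of the
sources have a common nonzero value. -/
theorem exists_ne_zero_apply_eq {U : Type*} [AddCommGroup U] [Module F U] [Module.Finite F U]
    [Module.Finite F V] [Module.Finite F W]
    {f : V →ₗ[F] U} {g : W →ₗ[F] U} (hf : Function.Injective f) (hg : Function.Injective g)
    (h : Module.finrank F U < Module.finrank F V + Module.finrank F W) :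
    ∃ v w, v ≠ 0 ∧ w ≠ 0 ∧ f v = g w := by
  obtain ⟨⟨v, w⟩, hx, h0⟩ := Submodule.exists_mem_ne_zero_of_ne_bot
    (LinearMap.ker_ne_bot_of_finrank_lt (f := f.coprod (-g)) (by rwa [Module.finrank_prod]))
  have hx' : f v = g w := by
    rw [LinearMap.mem_ker, LinearMap.coprod_apply, LinearMap.neg_apply, add_neg_eq_zero] at hx
    exact hx
  refine ⟨v, w, ?_, ?_, hx'⟩
  · rintro rfl
    rw [map_zero, eq_comm, map_eq_zero_iff g hg] at hx'
    exact h0 (by rw [hx']; rfl)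
  · rintro rfl
    rw [map_zero, map_eq_zero_iff f hf] at hx'
    exact h0 (by rw [hx']; rfl)

theorem IsPfisterNeighbor.closure_valueSet_eq [Module.Finite F V] [Module.Finite F W]
    {q : QuadraticForm F V} {φ : QuadraticForm F W}
    (h : IsPfisterNeighbor q φ) :
    Subgroup.closure (valueSet q * valueSet q) = Subgroup.closure (valueSet φ * valueSet φ) := by
  obtain ⟨hq, n, hφ, hn, c, f, hf⟩ := h
  have hqf (v : V) : φ (f v) = c * q v := f.map_app v
  have hle {a : Fˣ} (ha : a ∈ valueSet q) : c * a ∈ valueSet φ := by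
    obtain ⟨v, hv⟩ := ha
    exact ⟨f v, by rw [hqf, hv, Units.val_mul]⟩
  rw [hφ.closure_valueSet]
  refine le_antisymm ((Subgroup.closure_le _).mpr ?_) fun d hd => ?_
  · rintro _ ⟨a, ha, b, hb, rfl⟩
    -- The scaling disappears in products: `ab = c⁻² (ca)(cb)`.
    have := mul_sq_mem_valueSet (hφ.isRound.mul_mem_valueSet (hle ha) (hle hb)) c⁻¹
    change a * b ∈ valueSet φ
    convert this using 1
    rw [mul_mul_mul_comm c a c b, ← mul_assoc, mul_mul_mul_comm c⁻¹ c⁻¹ c c]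
    simp
  by_cases hiso : ∃ v, v ≠ 0 ∧ q v = 0
  · obtain ⟨v, hv, h0⟩ := hiso
    rw [hq.valueSet_eq_univ hv h0, Set.univ_mul_univ, Subgroup.closure_univ]
    trivial
  push Not at hiso
  obtain ⟨u, hu⟩ := hd
  obtain ⟨σ, hσ⟩ := hφ.isRound u (by rw [hu]; exact d.ne_zero)
  -- Roundness does not provide an injective `σ`; anisotropy of `q` makes it injective on the image
  -- of `f`.
  have hinj : Function.Injective (σ ∘ₗ f.toLinearMap) := by
    rw [injective_iff_map_eq_zero]
    intro v hv
    by_contra hv0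
    have h1 : φ (σ (f v)) = d * (c * q v) := by rw [hσ, hqf, hu]
    have h2 : σ (f v) = 0 := hv
    rw [h2, QuadraticMap.map_zero] at h1
    exact mul_ne_zero d.ne_zero (mul_ne_zero c.ne_zero (hiso v hv0)) h1.symm
  -- Both images have dimension greater than half of `2 ^ n`, so they meet.
  obtain ⟨v, w, hv, hw, hvw⟩ := exists_ne_zero_apply_eq (f := f.toLinearMap) hf hinj
    (by rw [hφ.finrank_eq]; omega)
  have h1 : c * q v = d * (c * q w) := by
    rw [← hqf, ← hqf, ← hu, ← hσ]
    exact congrArg φ hvw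
  let a := Units.mk0 _ (hiso v hv)
  let b := Units.mk0 _ (hiso w hw)
  have hab : d = (a * b) * (b * b)⁻¹ := by
    rw [eq_mul_inv_iff_mul_eq]
    ext
    have : q v = d * q w := mul_left_cancel₀ c.ne_zero (by rw [h1]; ring)
    simp only [a, b, Units.val_mul, Units.val_mk0, this]
    ring
  rw [hab]
  have ha : a ∈ valueSet q := ⟨v, rfl⟩
  have hb : b ∈ valueSet q := ⟨w, rfl⟩
  exact mul_mem (Subgroup.subset_closure (Set.mul_mem_mul ha hb))
    (inv_mem (Subgroup.subset_closure (Set.mul_mem_mul hb hb)))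

end Values

/-! ### Extension of scalars -/

section ExtendScalars

variable {k : Type*} [Field k] [Invertible (2 : k)] (E : Type*) [Field E] [Algebra k E]
  {ι κ : Type} [Fintype ι] [DecidableEq ι] [Fintype κ] [DecidableEq κ]

/-- The extension of a quadratic form in coordinates to a larger field. -/
noncomputable def extendScalars (q : QuadraticForm k (ι → k)) : QuadraticForm E (ι → E) :=
  ((QuadraticForm.toMatrix' q).map (algebraMap k E)).toQuadraticForm'

theorem toQuadraticForm'_apply {R : Type*} [CommRing R] (A : Matrix ι ι R) (v : ι → R) :
    A.toQuadraticForm' v = v ⬝ᵥ A.mulVec v := by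
  rw [Matrix.toQuadraticForm', LinearMap.BilinMap.toQuadraticMap_apply, Matrix.toLinearMap₂'_apply']

theorem toQuadraticForm'_mulVec {R : Type*} [CommRing R] (A : Matrix ι ι R) (M : Matrix ι κ R)
    (v : κ → R) : A.toQuadraticForm' (M.mulVec v) = (M.transpose * A * M).toQuadraticForm' v := by
  rw [toQuadraticForm'_apply, toQuadraticForm'_apply, ← Matrix.mulVec_mulVec,
    ← Matrix.mulVec_mulVec, Matrix.dotProduct_mulVec v, Matrix.vecMul_transpose]

theorem extendScalars_apply (q : QuadraticForm k (ι → k)) (v : ι → E) :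
    extendScalars E q v =
      ∑ i, ∑ j, algebraMap k E (QuadraticForm.toMatrix' q i j) * (v i * v j) := by
  rw [extendScalars, toQuadraticForm'_apply, dotProduct]
  refine Finset.sum_congr rfl fun i _ => ?_
  rw [Matrix.mulVec, dotProduct, Finset.mul_sum]
  refine Finset.sum_congr rfl fun j _ => ?_
  rw [Matrix.map_apply]
  ring

theorem extendScalars_smul (c : k) (q : QuadraticForm k (ι → k)) (v : ι → E) :
    extendScalars E (c • q) v = algebraMap k E c * extendScalars E q v := by
  rw [extendScalars_apply, extendScalars_apply, QuadraticForm.toMatrix'_smul, Finset.mul_sum]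
  refine Finset.sum_congr rfl fun i _ => ?_
  rw [Finset.mul_sum]
  refine Finset.sum_congr rfl fun j _ => ?_
  rw [Matrix.smul_apply, smul_eq_mul, map_mul]
  ring

/-- Injective isometries extend to larger fields. -/
theorem exists_isometry_extendScalars {q : QuadraticForm k (ι → k)} {φ : QuadraticForm k (κ → k)}
    (f : q →qᵢ φ) (hf : Function.Injective f) :
    ∃ g : extendScalars E q →qᵢ extendScalars E φ, Function.Injective g := by
  -- A left inverse is a matrix identity over `k`, so it survives the passage to `E` and keeps the
  -- extended map injective.
  obtain ⟨g, hg⟩ := f.toLinearMap.exists_leftInverse_of_injective (LinearMap.ker_eq_bot.mpr hf)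
  have hq : QuadraticForm.toMatrix' q = (LinearMap.toMatrix' f.toLinearMap).transpose *
      QuadraticForm.toMatrix' φ * LinearMap.toMatrix' f.toLinearMap := by
    rw [← QuadraticForm.toMatrix'_comp]
    congr 1
    ext v
    exact (f.map_app v).symm
  let M := (LinearMap.toMatrix' f.toLinearMap).map (algebraMap k E)
  refine ⟨⟨M.mulVecLin, fun v => ?_⟩, ?_⟩
  · change extendScalars E φ (M.mulVec v) = _
    rw [extendScalars, toQuadraticForm'_mulVec, extendScalars, hq, Matrix.map_mul, Matrix.map_mul,
      Matrix.transpose_map]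
  · refine Function.LeftInverse.injective
      (g := ((LinearMap.toMatrix' g).map (algebraMap k E)).mulVec) fun v => ?_
    change ((LinearMap.toMatrix' g).map (algebraMap k E)).mulVec (M.mulVec v) = v
    rw [Matrix.mulVec_mulVec, ← Matrix.map_mul, ← LinearMap.toMatrix'_comp, hg,
      LinearMap.toMatrix'_id, Matrix.map_one _ (map_zero _) (map_one _), Matrix.one_mulVec]

theorem extendScalars_weightedSumSquares (w : ι → k) :
    extendScalars E (QuadraticMap.weightedSumSquares k w) =
      QuadraticMap.weightedSumSquares E fun i => algebraMap k E (w i) := by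
  have h : QuadraticForm.toMatrix' (QuadraticMap.weightedSumSquares k w) = Matrix.diagonal w := by
    have h2 : QuadraticMap.weightedSumSquares k w = (Matrix.diagonal w).toQuadraticForm' := by
      ext v
      rw [QuadraticMap.weightedSumSquares_apply, toQuadraticForm'_apply, dotProduct]
      refine Finset.sum_congr rfl fun i _ => ?_
      rw [Matrix.mulVec_diagonal, smul_eq_mul]
      ring
    rw [h2, QuadraticForm.toMatrix', Matrix.toQuadraticForm',
      QuadraticMap.associated_left_inverse, LinearMap.toMatrix'_toLinearMap₂']
    intro x y
    rw [Matrix.toLinearMap₂'_apply', Matrix.toLinearMap₂'_apply', Matrix.dotProduct_mulVec,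
      dotProduct_comm, ← Matrix.mulVec_transpose, Matrix.diagonal_transpose]
  ext v
  rw [extendScalars_apply, QuadraticMap.weightedSumSquares_apply, h]
  refine Finset.sum_congr rfl fun i _ => ?_
  rw [Finset.sum_eq_single i]
  · rw [Matrix.diagonal_apply_eq, smul_eq_mul]
  · intro j _ hj
    rw [Matrix.diagonal_apply_ne' _ hj, map_zero, zero_mul]
  · simp

theorem extendScalars_pfisterForm {n : ℕ} (a : Fin n → kˣ) :
    extendScalars E (pfisterForm a) = pfisterForm fun i => Units.map (algebraMap k E) (a i) := by
  rw [pfisterForm, extendScalars_weightedSumSquares, pfisterForm]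
  congr 1
  funext e
  rw [map_prod]
  refine Finset.prod_congr rfl fun i _ => ?_
  rcases e i with ⟨_ | _ | j, hj⟩
  · simp
  · simp
  · omega

theorem IsPfisterForm.isHyperbolicOfIsotropic_extendScalars {n : ℕ} {φ : QuadraticForm k (ι → k)}
    (h : IsPfisterForm n φ) : IsHyperbolicOfIsotropic (extendScalars E φ) := by
  obtain ⟨a, ⟨e⟩⟩ := h
  rintro ⟨v, hv, h0⟩
  -- The two directions of `e` are extended separately: `f` carries the isotropic vector over, `g`
  -- carries the subspace back. Injectivity of each suffices; that they are mutually inverse is not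
  -- needed.
  obtain ⟨f, hf⟩ := exists_isometry_extendScalars E e.toIsometry e.toLinearEquiv.injective
  obtain ⟨g, hg⟩ := exists_isometry_extendScalars E e.symm.toIsometry
    e.symm.toLinearEquiv.injective
  have hP := isHyperbolicOfIsotropic_pfisterForm fun i => Units.map (algebraMap k E : k →* E) (a i)
  rw [← extendScalars_pfisterForm] at hP
  obtain ⟨L, hL, hd⟩ := hP
    ⟨f v, (map_ne_zero_iff f.toLinearMap hf).mpr hv, by rw [f.map_app, h0]⟩
  refine ⟨L.map g.toLinearMap, ?_, ?_⟩
  · rintro _ ⟨x, hx, rfl⟩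
    exact (g.map_app x).trans (hL x hx)
  · rw [(L.equivMapOfInjective g.toLinearMap hg).symm.finrank_eq, hd,
      Module.finrank_fintype_fun_eq_card, Module.finrank_fintype_fun_eq_card,
      ← Module.finrank_fintype_fun_eq_card k, ← Module.finrank_fintype_fun_eq_card k,
      e.toLinearEquiv.finrank_eq]

/-- A Pfister neighbor is isotropic over a field if and only if its Pfister form is. -/
theorem IsPfisterNeighbor.isotropic_iff {q : QuadraticForm k (ι → k)} {φ : QuadraticForm k (κ → k)}
    (h : IsPfisterNeighbor q φ) :
    (∃ v, v ≠ 0 ∧ extendScalars E q v = 0) ↔ ∃ v, v ≠ 0 ∧ extendScalars E φ v = 0 := by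
  obtain ⟨_, n, hφ, hn, c, f, hf⟩ := h
  obtain ⟨g, hg⟩ := exists_isometry_extendScalars E f hf
  have hc : algebraMap k E c ≠ 0 := (map_ne_zero _).mpr c.ne_zero
  have hgq (v : ι → E) : extendScalars E φ (g v) = algebraMap k E c * extendScalars E q v := by
    rw [g.map_app, extendScalars_smul]
  constructor
  · rintro ⟨v, hv, h0⟩
    exact ⟨g v, (map_ne_zero_iff g.toLinearMap hg).mpr hv, by rw [hgq, h0, mul_zero]⟩
  · intro hiso
    obtain ⟨L, hL, hd⟩ := hφ.isHyperbolicOfIsotropic_extendScalars E hiso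
    -- From `2 * dim L = 2 ^ n < 2 * dim q`, the dimensions of `L` and of the image of `q` add up to
    -- more than `2 ^ n`.
    obtain ⟨v, w, hv, _, hvw⟩ := exists_ne_zero_apply_eq (f := g.toLinearMap) (g := L.subtype) hg
      L.injective_subtype (by
        have h1 := hφ.finrank_eq
        rw [Module.finrank_fintype_fun_eq_card] at h1 hn hd ⊢
        rw [Module.finrank_fintype_fun_eq_card]
        omega)
    refine ⟨v, hv, ?_⟩
    have h2 := hL (g v) (by
      have : g v = w := hvw
      rw [this]
      exact w.2)
    rw [hgq] at h2
    exact (mul_eq_zero.mp h2).resolve_left hc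

end ExtendScalars

/-! ### Transfers in towers -/

section Tower

variable {k K E : Type u} [Field k] [Field K] [Field E] [Algebra k K] [Algebra k E] [Algebra K E]
  [IsScalarTower k K E]

/-- The pairing `(d, c) ↦ t (d * c)` on `K` is nondegenerate, so the functional `c ↦ s (c • x)`
equals `c ↦ t (d * c)` for a unique `d`, and `u x = d`. Uniqueness makes `u` linear over `K`. Thus
every nonzero `s` factors through any prescribed `t`, which is why the choices of functionals do not
matter. -/
theorem exists_comp_eq [Module.Finite k K] {s : E →ₗ[k] k} (hs : s ≠ 0) {t : K →ₗ[k] k}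
    (ht : t ≠ 0) :
    ∃ u : E →ₗ[K] K, u ≠ 0 ∧ ∀ x, t (u x) = s x := by
  let Θ : K →ₗ[k] Module.Dual k K := (LinearMap.mul k K).compr₂ t
  have hΘ : Function.Injective Θ := by
    rw [injective_iff_map_eq_zero]
    intro d hd
    by_contra hd0
    refine ht (LinearMap.ext fun c => ?_)
    have := LinearMap.congr_fun hd (d⁻¹ * c)
    simpa [Θ, mul_inv_cancel_left₀ hd0] using this
  have hsurj : Function.Surjective Θ :=
    (LinearMap.injective_iff_surjective_of_finrank_eq_finrank
      (Subspace.dual_finrank_eq (K := k) (V := K)).symm).mp hΘ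
  have hex (x : E) : ∃ d : K, ∀ c : K, t (d * c) = s (c • x) := by
    obtain ⟨d, hd⟩ := hsurj (s ∘ₗ (LinearMap.toSpanSingleton K E x).restrictScalars k)
    exact ⟨d, fun c => LinearMap.congr_fun hd c⟩
  choose u hu using hex
  have huniq {d d' : K} (h : ∀ c, t (d * c) = t (d' * c)) : d = d' := hΘ (LinearMap.ext h)
  let U : E →ₗ[K] K :=
    { toFun := u
      map_add' := fun x y => huniq fun c => by rw [hu, add_mul, map_add, hu, hu, smul_add, map_add]
      map_smul' := fun b x => huniq fun c => by
        rw [hu, RingHom.id_apply, smul_eq_mul, mul_comm b, mul_assoc, hu, smul_smul, mul_comm b] }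
  have hU (x : E) : t (U x) = s x := by
    rw [← mul_one (U x), ← one_smul K x]
    exact (hu _ 1).trans (by rw [one_smul, one_smul])
  refine ⟨U, ?_, hU⟩
  rintro h0
  exact hs (LinearMap.ext fun x => by rw [← hU, h0, LinearMap.zero_apply, map_zero,
    LinearMap.zero_apply])

theorem scharlauTransfer_of [Module.Finite k E] {s : E →ₗ[k] k} (hs : s ≠ 0)
    (V : IsometryClass E) :
    scharlauTransfer s hs (Algebra.GrothendieckAddGroup.of V) =
      Algebra.GrothendieckAddGroup.of (transferClass s hs V) :=
  DFunLike.congr_fun (Algebra.GrothendieckAddGroup.lift.symm_apply_apply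
    (Algebra.GrothendieckAddGroup.of.comp (transferClass s hs))) V

theorem transferClass_transferClass [Module.Finite k K] [Module.Finite k E] [Module.Finite K E]
    {s : E →ₗ[k] k} (hs : s ≠ 0) {t : K →ₗ[k] k} (ht : t ≠ 0) {u : E →ₗ[K] K} (hu : u ≠ 0)
    (h : ∀ x, t (u x) = s x) (a : IsometryClass E) :
    transferClass s hs a = transferClass t ht (transferClass u hu a) := by
  induction a using Quotient.inductionOn with | _ V => ?_
  have hV (c : k) (x : V.carrier) :
      algebraMap k E c • x = algebraMap K E (algebraMap k K c) • x := by
    rw [IsScalarTower.algebraMap_apply k K E c]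
  exact Quotient.sound ⟨⟨{ Equiv.refl V.carrier with
      map_add' := fun _ _ => rfl
      map_smul' := hV },
    fun x => h (V.form x)⟩⟩

theorem scharlauTransfer_comp [Module.Finite k K] [Module.Finite k E] [Module.Finite K E]
    {s : E →ₗ[k] k} (hs : s ≠ 0) {t : K →ₗ[k] k} (ht : t ≠ 0) {u : E →ₗ[K] K} (hu : u ≠ 0)
    (h : ∀ x, t (u x) = s x) :
    scharlauTransfer s hs = (scharlauTransfer t ht).comp (scharlauTransfer u hu) := by
  refine Algebra.GrothendieckAddGroup.lift.symm.injective (AddMonoidHom.ext fun V => ?_)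
  change scharlauTransfer s hs (Algebra.GrothendieckAddGroup.of V) =
    scharlauTransfer t ht (scharlauTransfer u hu (Algebra.GrothendieckAddGroup.of V))
  rw [scharlauTransfer_of, scharlauTransfer_of, scharlauTransfer_of,
    transferClass_transferClass hs ht hu h]

theorem range_scharlauTransfer_le [Module.Finite k K] [Module.Finite k E]
    {s : E →ₗ[k] k} (hs : s ≠ 0) {t : K →ₗ[k] k} (ht : t ≠ 0) :
    (scharlauTransfer s hs).range ≤ (scharlauTransfer t ht).range := by
  have : Module.Finite K E := Module.Finite.of_restrictScalars_finite k K E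
  obtain ⟨u, hu, h⟩ := exists_comp_eq hs ht
  rw [scharlauTransfer_comp hs ht hu h]
  rintro _ ⟨x, rfl⟩
  exact ⟨_, rfl⟩

end Tower

/-! ### Points of schemes over a field -/

section Points

variable {k : Type u} [Field k]

/-- A point with values in a finite extension of the base field factors through the residue field
of a closed point. -/
theorem exists_closedPoint_algHom {X : Scheme.{u}} [X.Over (Spec (.of k))]
    [LocallyOfFiniteType (X ↘ Spec (.of k))] {E : Type u} [Field E] [Algebra k E]
    [Module.Finite k E] (g : Spec (.of E) ⟶ X)
    (hg : g ≫ X ↘ Spec (.of k) = Spec.map (CommRingCat.ofHom (algebraMap k E))) :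
    ∃ y : closedPoints X, Nonempty (X.residueField y.1 →ₐ[k] E) := by
  have : IsFinite (g ≫ X ↘ Spec (.of k)) := by
    rw [hg, IsFinite.SpecMap_iff]
    exact (RingHom.finite_algebraMap).mpr inferInstance
  have : LocallyOfFiniteType g := locallyOfFiniteType_of_comp g (X ↘ Spec (.of k))
  have : JacobsonSpace X := LocallyOfFiniteType.jacobsonSpace (X ↘ Spec (.of k))
  -- The Nullstellensatz enters here: `X` is Jacobson, so a morphism locally of finite type from the
  -- spectrum of a field is finite, hence closed, and its image is a closed point.
  have : IsFinite g := by
    rw [isFinite_iff_locallyOfFiniteType_of_jacobsonSpace]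
    infer_instance
  have hy : IsClosed {g (IsLocalRing.closedPoint E)} := by
    have h1 := g.isClosedMap _ (isClosed_univ)
    rw [Set.image_univ, Set.range_unique] at h1
    convert h1
    exact congrArg g (Subsingleton.elim (α := PrimeSpectrum E) _ _)
  let d := X.descResidueField (Scheme.stalkClosedPointTo g)
  refine ⟨⟨_, hy⟩, ⟨{ d.hom with commutes' := fun c => ?_ }⟩⟩
  have h2 := Scheme.descResidueField_stalkClosedPointTo_fromSpecResidueField E X g
  have h3 : Spec.preimage (X.fromSpecResidueField (g (IsLocalRing.closedPoint E)) ≫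
      X ↘ Spec (.of k)) ≫ d = CommRingCat.ofHom (algebraMap k E) := by
    apply Spec.map_injective
    rw [Spec.map_comp, Spec.map_preimage, ← hg, ← Category.assoc, h2]
  exact congrArg (fun m => m.hom c) h3

variable {A : Type u} [CommRing A] [Algebra k A] (𝒜 : ℕ → Submodule k A) [GradedAlgebra 𝒜]

/-- The structure map of a standard affine chart of `Proj`. -/
noncomputable def awayScalar (f : A) : k →+* HomogeneousLocalization.Away 𝒜 f :=
  (HomogeneousLocalization.fromZeroRingHom 𝒜 _).comp (algebraMap k (𝒜 0))

theorem val_awayScalar (f : A) (c : k) :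
    (awayScalar 𝒜 f c).val = algebraMap A (Localization.Away f) (algebraMap k A c) := by
  exact Localization.mk_one_eq_algebraMap (algebraMap k A c)

theorem awayι_over {f : A} {d : ℕ} (hf : f ∈ 𝒜 d) (hd : 0 < d) :
    Proj.awayι 𝒜 f hf hd ≫ Proj 𝒜 ↘ Spec (.of k) =
      Spec.map (CommRingCat.ofHom (awayScalar 𝒜 f)) := by
  change Proj.awayι 𝒜 f hf hd ≫ Proj.toSpecZero 𝒜 ≫
    Spec.map (CommRingCat.ofHom (algebraMap k (𝒜 0))) = _
  rw [Proj.awayι_toSpecZero_assoc, ← Spec.map_comp]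
  rfl

/-- The morphism from the spectrum of the residue field has image `{x}`, so it lifts through the
open immersion of the chart. -/
theorem exists_ringHom_residueField {f : A} {d : ℕ} (hf : f ∈ 𝒜 d) (hd : 0 < d) {x : Proj 𝒜}
    (hx : x ∈ Proj.basicOpen 𝒜 f) :
    ∃ ψ : HomogeneousLocalization.Away 𝒜 f →+* (Proj 𝒜).residueField x,
      ∀ c : k, ψ (awayScalar 𝒜 f c) = algebraMap k ((Proj 𝒜).residueField x) c := by
  let g := IsOpenImmersion.lift (Proj.awayι 𝒜 f hf hd) ((Proj 𝒜).fromSpecResidueField x) (by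
    rw [Scheme.range_fromSpecResidueField, Set.singleton_subset_iff]
    rwa [← Proj.opensRange_awayι 𝒜 f hf hd] at hx)
  have hg : g ≫ Proj.awayι 𝒜 f hf hd = (Proj 𝒜).fromSpecResidueField x :=
    IsOpenImmersion.lift_fac _ _ _
  refine ⟨(Spec.preimage g).hom, fun c => ?_⟩
  have h : CommRingCat.ofHom (awayScalar 𝒜 f) ≫ Spec.preimage g =
      Spec.preimage ((Proj 𝒜).fromSpecResidueField x ≫ Proj 𝒜 ↘ Spec (.of k)) := by
    apply Spec.map_injective
    rw [Spec.map_comp, Spec.map_preimage, Spec.map_preimage, ← awayι_over 𝒜 hf hd, ← hg,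
      Category.assoc]
  exact congrArg (fun m => m.hom c) h

/-- A point of the affine cone with `f ≠ 0` determines a projective point: `g` extends to the
localization at `f` and is then restricted to degree zero. -/
theorem exists_closedPoint_algHom_of_away [LocallyOfFiniteType (Proj 𝒜 ↘ Spec (.of k))]
    {E : Type u} [Field E] [Algebra k E] [Module.Finite k E]
    {f : A} {d : ℕ} (hf : f ∈ 𝒜 d) (hd : 0 < d) (g : A →ₐ[k] E) (hgf : g f ≠ 0) :
    ∃ y : closedPoints (Proj 𝒜), Nonempty ((Proj 𝒜).residueField y.1 →ₐ[k] E) := by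
  let ψ : HomogeneousLocalization.Away 𝒜 f →+* E :=
    (Localization.awayLift g.toRingHom f (isUnit_iff_ne_zero.mpr hgf)).comp
      (algebraMap _ (Localization.Away f))
  refine exists_closedPoint_algHom (Spec.map (CommRingCat.ofHom ψ) ≫ Proj.awayι 𝒜 f hf hd) ?_
  rw [Category.assoc, awayι_over, ← Spec.map_comp, ← CommRingCat.ofHom_comp]
  congr 2
  ext c
  change Localization.awayLift g.toRingHom f (isUnit_iff_ne_zero.mpr hgf)
    (awayScalar 𝒜 f c).val = _
  rw [val_awayScalar, Localization.awayLift, IsLocalization.Away.lift_eq]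
  exact g.commutes c

end Points

/-! ### Points of projective quadrics -/

section QuadricPoints

variable {k : Type u} [Field k] [Invertible (2 : k)] {m : ℕ} (q : QuadraticForm k (Fin m → k))

/-- The coordinates on the projective quadric. -/
noncomputable abbrev quadricCoord (i : Fin m) : MvPolynomial (Fin m) k ⧸ (quadricIdeal q).toIdeal :=
  Ideal.Quotient.mk _ (MvPolynomial.X i)

theorem quadricCoord_mem (i : Fin m) : quadricCoord q i ∈ quadricGrading q 1 :=
  ⟨MvPolynomial.X i, MvPolynomial.isHomogeneous_X k i, rfl⟩

theorem iSup_basicOpen_quadricCoord :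
    ⨆ i, Proj.basicOpen (quadricGrading q) (quadricCoord q i) = ⊤ := by
  refine Proj.iSup_basicOpen_eq_top' _ _ (fun i => ⟨1, quadricCoord_mem q i⟩) ?_
  rw [eq_top_iff]
  rintro p -
  obtain ⟨p, rfl⟩ := Ideal.Quotient.mk_surjective p
  induction p using MvPolynomial.induction_on with
  | C c =>
    have hc : Ideal.Quotient.mk (quadricIdeal q).toIdeal (MvPolynomial.C c) ∈
      quadricGrading q 0 := ⟨MvPolynomial.C c, MvPolynomial.isHomogeneous_C _ c, rfl⟩
    exact Subalgebra.algebraMap_mem (Algebra.adjoin (quadricGrading q 0) _)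
      (⟨_, hc⟩ : quadricGrading q 0)
  | add p r hp hr => rw [map_add]; exact add_mem hp hr
  | mul_X p i hp =>
    rw [map_mul]
    exact mul_mem hp (Algebra.subset_adjoin ⟨i, rfl⟩)

theorem aeval_formPolynomial {E : Type*} [Field E] [Algebra k E] (v : Fin m → E) :
    MvPolynomial.aeval v (formPolynomial q) = extendScalars E q v := by
  rw [extendScalars_apply, formPolynomial]
  simp

theorem exists_closedPoint_of_isotropic {E : Type u} [Field E] [Algebra k E] [Module.Finite k E]
    (h : ∃ v, v ≠ 0 ∧ extendScalars E q v = 0) :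
    ∃ y : closedPoints (projectiveQuadric q),
      Nonempty ((projectiveQuadric q).residueField y.1 →ₐ[k] E) := by
  obtain ⟨v, hv, h0⟩ := h
  obtain ⟨i, hi⟩ := Function.ne_iff.mp hv
  let g : (MvPolynomial (Fin m) k ⧸ (quadricIdeal q).toIdeal) →ₐ[k] E :=
    Ideal.Quotient.liftₐ _ (MvPolynomial.aeval v) fun p hp => by
      have hp' : p ∈ Ideal.span {formPolynomial q} := hp
      obtain ⟨r, rfl⟩ := Ideal.mem_span_singleton'.mp hp'
      rw [map_mul, aeval_formPolynomial, h0, mul_zero]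
  refine exists_closedPoint_algHom_of_away (quadricGrading q) (quadricCoord_mem q i) one_pos g ?_
  change MvPolynomial.aeval v (MvPolynomial.X i) ≠ 0
  rwa [MvPolynomial.aeval_X]

theorem isotropic_residueField (x : projectiveQuadric q) :
    ∃ v, v ≠ 0 ∧ extendScalars ((projectiveQuadric q).residueField x) q v = 0 := by
  have hx : x ∈ ⨆ i, Proj.basicOpen (quadricGrading q) (quadricCoord q i) := by
    rw [iSup_basicOpen_quadricCoord]
    trivial
  obtain ⟨i, hi⟩ := TopologicalSpace.Opens.mem_iSup.mp hx
  obtain ⟨ψ, hψ⟩ := exists_ringHom_residueField (quadricGrading q) (quadricCoord_mem q i) one_pos hi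
  -- The isotropic vector is the tautological one, with entries `x_j / x_i`. Its `i`-th entry is
  -- `1`, so it is nonzero.
  let w (j : Fin m) : HomogeneousLocalization.Away (quadricGrading q) (quadricCoord q i) :=
    HomogeneousLocalization.Away.mk _ (quadricCoord_mem q i) 1 (quadricCoord q j)
      (by rw [one_smul]; exact quadricCoord_mem q j)
  let B := Localization.Away (quadricCoord q i)
  let t : B := Localization.mk 1 ⟨quadricCoord q i, Submonoid.mem_powers _⟩
  have hw (j : Fin m) : (w j).val = algebraMap _ B (quadricCoord q j) * t := by
    rw [HomogeneousLocalization.Away.val_mk, ← Localization.mk_one_eq_algebraMap,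
      Localization.mk_mul]
    simp only [pow_one, mul_one, one_mul]
  refine ⟨fun j => ψ (w j), fun h => ?_, ?_⟩
  · have h1 : w i = 1 := by
      refine HomogeneousLocalization.val_injective _ ?_
      rw [HomogeneousLocalization.Away.val_mk, HomogeneousLocalization.val_one]
      simp only [pow_one]
      exact Localization.mk_self (⟨quadricCoord q i, Submonoid.mem_powers _⟩ : Submonoid.powers _)
    have := congrFun h i
    simp [h1] at this
  · have h2 : ∑ a, ∑ b, awayScalar (quadricGrading q) (quadricCoord q i)
        (QuadraticForm.toMatrix' q a b) * (w a * w b) = 0 := by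
      refine HomogeneousLocalization.val_injective _ ?_
      have h3 : algebraMap _ B
          (Ideal.Quotient.mk (quadricIdeal q).toIdeal (formPolynomial q)) = 0 := by
        rw [Ideal.Quotient.eq_zero_iff_mem.mpr, map_zero]
        exact Ideal.mem_span_singleton_self _
      -- Degree two homogeneity: dividing each coordinate by `x_i` divides the form by `x_i ^ 2`.
      have h4 : HomogeneousLocalization.val (∑ a, ∑ b,
          awayScalar (quadricGrading q) (quadricCoord q i)
            (QuadraticForm.toMatrix' q a b) * (w a * w b)) =
          algebraMap _ B (Ideal.Quotient.mk (quadricIdeal q).toIdeal (formPolynomial q)) *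
            (t * t) := by
        rw [← HomogeneousLocalization.algebraMap_apply, formPolynomial]
        simp only [map_sum, map_mul, HomogeneousLocalization.algebraMap_apply, val_awayScalar, hw,
          Finset.sum_mul]
        refine Finset.sum_congr rfl fun a _ => Finset.sum_congr rfl fun b _ => ?_
        rw [mul_mul_mul_comm _ t]
        exact (mul_assoc _ _ _).symm
      rw [h4, h3, zero_mul, HomogeneousLocalization.val_zero]
    rw [extendScalars_apply, ← map_zero ψ, ← h2]
    simp only [map_sum, map_mul, hψ]

end QuadricPoints

theorem IsPfisterNeighbor.transferIdeal_eq {k : Type u} [Field k] [Invertible (2 : k)] {m r : ℕ}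
    {q : QuadraticForm k (Fin m → k)} {φ : QuadraticForm k (Fin r → k)}
    (h : IsPfisterNeighbor q φ) (s : FunctionalChoice k (projectiveQuadric q))
    (t : FunctionalChoice k (projectiveQuadric φ)) :
    transferIdeal k (projectiveQuadric q) s = transferIdeal k (projectiveQuadric φ) t := by
  have key {a b : ℕ} {f : QuadraticForm k (Fin a → k)} {g : QuadraticForm k (Fin b → k)}
      (hfg : ∀ (E : Type u) [Field E] [Algebra k E],
        (∃ v, v ≠ 0 ∧ extendScalars E f v = 0) → ∃ v, v ≠ 0 ∧ extendScalars E g v = 0)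
      (s : FunctionalChoice k (projectiveQuadric f))
      (t : FunctionalChoice k (projectiveQuadric g)) :
      transferIdeal k (projectiveQuadric f) s ≤ transferIdeal k (projectiveQuadric g) t := by
    refine iSup_le fun x => ?_
    -- Isotropy passes from `f` to `g` over `k(x)`; the resulting `k(x)`-point of the second quadric
    -- lies over a closed point `y`, and `j` embeds `k(y)` into `k(x)`.
    obtain ⟨y, ⟨j⟩⟩ := exists_closedPoint_of_isotropic g (hfg _ (isotropic_residueField f x.1))
    let _ := j.toRingHom.toAlgebra
    have : IsScalarTower k ((projectiveQuadric g).residueField y.1)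
        ((projectiveQuadric f).residueField x.1) :=
      IsScalarTower.of_algebraMap_eq fun c => (j.commutes c).symm
    exact (range_scharlauTransfer_le (s.ne_zero x) (t.ne_zero y)).trans
      (le_iSup (fun y => (scharlauTransfer (t.toFun y) (t.ne_zero y)).range) y)
  exact le_antisymm (key (fun E _ _ => (h.isotropic_iff E).mp) s t)
    (key (fun E _ _ => (h.isotropic_iff E).mpr) t s)

end QuadraticForms

theorem lemma3p9 {k : Type u} [Field k] [Invertible (2 : k)] {m r : ℕ}
    (q : QuadraticForm k (Fin m → k)) (φ : QuadraticForm k (Fin r → k))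
    (h : QuadraticForms.IsPfisterNeighbor q φ) :
    (∀ (s : QuadraticForms.FunctionalChoice k (QuadraticForms.projectiveQuadric q))
        (t : QuadraticForms.FunctionalChoice k (QuadraticForms.projectiveQuadric φ)),
      QuadraticForms.transferIdeal k (QuadraticForms.projectiveQuadric q) s =
        QuadraticForms.transferIdeal k (QuadraticForms.projectiveQuadric φ) t) ∧
    Subgroup.closure (QuadraticForms.valueSet q * QuadraticForms.valueSet q) =
      Subgroup.closure (QuadraticForms.valueSet φ * QuadraticForms.valueSet φ) ∧
    (Subgroup.closure (QuadraticForms.valueSet φ * QuadraticForms.valueSet φ) : Set kˣ) =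
      QuadraticForms.valueSet φ := by
  refine ⟨h.transferIdeal_eq, h.closure_valueSet_eq, ?_⟩
  obtain ⟨_, n, hφ, _⟩ := h
  rw [hφ.closure_valueSet]
  rfl
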